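/- Let $K$ be a field, $S=K[x_1,\ldots,x_n]$ with the standard grading, and let $n\ge n_0>n_1>\cdots>n_m\ge 1$ be integers. Let $a_{ij}$ ($0\le i\le m$, $1\le j\le n_i$) be positive integers, and put $Q_i=(x_1^{a_{i1}},\ldots,x_{n_i}^{a_{in_i}})\subset S$ and $I_i=\bigcap_{j=i}^m Q_j$ for $0\le i\le m$. Assume that the decomposition $I_0=\bigcap_{j=0}^m Q_j$ is irredundant, i.e. no $Q_i$ contains $\bigcap_{j\ne i}Q_j$ (an empty intersection being $S$). For a nonzero homogeneous ideal $J\subset S$ let $\operatorname{reg}(J)=\max\{j-i : \beta_{ij}(J)\ne 0\}$ be its Castelnuovo–Mumford regularity, where the graded Betti number $\beta_{ij}(J)$ is the number of basis elements of degree $j$ in the $i$-th module $F_i$ of a minimal graded free resolution $\cdots\to F_1\to F_0\to J\to 0$. If $a_{ij}\ge a_{i+1,j}$ for all $0\le i<m$ and $1\le j\le n_{i+1}$, then $$\operatorname{reg}(I_i)=\operatorname{reg}(Q_i)=a_{i1}+a_{i2}+\cdots+a_{in_i}-n_i+1\qquad\text{for all } 0\le i\le m.$$ -/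

import Mathlib

namespace BorelType

/-- A minimal graded free resolution `⋯ → F₂ → F₁ → F₀ → I → 0` of an ideal `I` of
`S = K[x_1, …, x_n]` (standard grading), where `F_i = ⊕_k S(-deg i k)` has the basis
`e_k`, `k : Fin (rank i)`, with `e_k` homogeneous of degree `deg i k`. Degrees are natural numbers:
in a minimal resolution of an ideal no other degrees can occur. -/
structure MinimalGradedFreeResolution {K : Type*} [Field K] {n : ℕ}
    (I : Ideal (MvPolynomial (Fin n) K)) where
  /-- the rank of `F_i` -/
  rank : ℕ → ℕ
  /-- the degrees of the basis elements of `F_i` -/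
  deg : (i : ℕ) → Fin (rank i) → ℕ
  /-- the augmentation `F₀ → S`, with image `I` -/
  aug : (Fin (rank 0) → MvPolynomial (Fin n) K) →ₗ[MvPolynomial (Fin n) K]
    MvPolynomial (Fin n) K
  /-- the differential `F_{i+1} → F_i` -/
  d : (i : ℕ) → (Fin (rank (i + 1)) → MvPolynomial (Fin n) K) →ₗ[MvPolynomial (Fin n) K]
    (Fin (rank i) → MvPolynomial (Fin n) K)
  /-- `F₀ → S` has image `I` -/
  range_aug : LinearMap.range aug = I
  /-- exactness at `F₀` -/
  exact_zero : LinearMap.range (d 0) = LinearMap.ker aug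
  /-- exactness at `F_{i+1}` -/
  exact_succ : ∀ i, LinearMap.range (d (i + 1)) = LinearMap.ker (d i)
  /-- `F₀ → S` is homogeneous of degree `0` -/
  aug_homogeneous : ∀ k, ∀ u ∈ (aug (Pi.single k 1)).support, u.degree = deg 0 k
  /-- `F_{i+1} → F_i` is homogeneous of degree `0`: every monomial in the `(l, k)` entry of its
  matrix has degree `deg e_k - deg e_l` -/
  d_homogeneous : ∀ i k l, ∀ u ∈ (d i (Pi.single k 1) l).support,
    u.degree + deg i l = deg (i + 1) k
  /-- minimality: the entries of the matrices lie in the ideal `(x_1, …, x_n)` -/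
  minimal : ∀ i k l, MvPolynomial.constantCoeff (d i (Pi.single k 1) l) = 0

/-- The graded Betti number `β_{ij}`, read off a minimal graded free resolution: the number
of basis elements of degree `j` in `F_i`. -/
noncomputable def MinimalGradedFreeResolution.betti {K : Type*} [Field K] {n : ℕ}
    {I : Ideal (MvPolynomial (Fin n) K)} (F : MinimalGradedFreeResolution I) (i j : ℕ) : ℕ :=
  (Finset.univ.filter fun k : Fin (F.rank i) => F.deg i k = j).card

/-- `reg(I) = r`, where `reg(I) = max {j - i : β_{ij}(I) ≠ 0}`. A minimal graded
free resolution exists, and the maximum, taken in any of them, exists and equals `r`. -/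
def HasRegularity {K : Type*} [Field K] {n : ℕ} (I : Ideal (MvPolynomial (Fin n) K))
    (r : ℤ) : Prop :=
  Nonempty (MinimalGradedFreeResolution I) ∧
    ∀ F : MinimalGradedFreeResolution I,
      IsGreatest {e : ℤ | ∃ i j : ℕ, F.betti i j ≠ 0 ∧ e = (j : ℤ) - (i : ℤ)} r

/-- The irreducible monomial ideal `Q = (x_1^{a_1}, …, x_r^{a_r})` of `K[x_1, …, x_n]`. The
variable `x_{j+1}` is `X j` for `j : Fin n`, and only the exponents `a j` with `j < r` matter. -/
noncomputable def irredIdeal (K : Type*) [Field K] {n : ℕ} (r : ℕ) (a : Fin n → ℕ) :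
    Ideal (MvPolynomial (Fin n) K) :=
  Ideal.span {p | ∃ j : Fin n, (j : ℕ) < r ∧ p = MvPolynomial.X j ^ a j}

/-- `I_i = ⋂_{j ≥ i} Q_j`. -/
noncomputable def tailInter {R : Type*} [CommRing R] {m : ℕ} (Q : Fin (m + 1) → Ideal R)
    (i : Fin (m + 1)) : Ideal R :=
  ⨅ j : Fin (m + 1), ⨅ _ : i ≤ j, Q j

/-- The intersection of the `Q_j` is irredundant: no `Q_i` contains the intersection
of the others. -/
def Irredundant {R : Type*} [CommRing R] {m : ℕ} (Q : Fin (m + 1) → Ideal R) : Prop :=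
  ∀ i : Fin (m + 1), ¬ (⨅ j : Fin (m + 1), ⨅ _ : j ≠ i, Q j) ≤ Q i

end BorelType

namespace BorelType

open MvPolynomial

variable {K : Type*} [Field K] {n : ℕ} {ι κ : Type*}

/-! ### Graded components of free modules -/

/-! Betti numbers are read off Koszul homology: `β_{pj}(I) ≠ 0` exactly when the Koszul complex of
the variables with coefficients in `I` has homology in homological degree `p` and internal degree
`j` (`betti_ne_zero_iff`). This comes from dimension shifting along a minimal resolution, since a
free module has Koszul homology only in homological degree zero, where it consists of constants. All
the work is then with explicit Koszul chains.

Write `I₀ = I₁ ∩ Q` with `Q = (x_1^{a_1}, …, x_r^{a_r})`, where `I₁` is a monomial ideal stable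
under division by `x_{r+1}, …, x_n`, and let `s` be the degree of the socle monomial `x^{a-1} = ∏_{j
≤ r} x_j^{a_j - 1}`.

Upper bound (`koszulAcyclic_inter`): division by `x_{r+1}, …, x_n` contracts the Koszul complex of
`I₁/I₀` onto chains in `x_1, …, x_r` alone, and every monomial in these variables of degree above
`s` lies in `Q`. Hence `reg I₀ ≤ max (reg I₁, s + 1)`.

Lower bound (`not_koszulAcyclic_inter`): if `x^{a-1} ∈ I₁`, then the boundary of `x^{a-1} e_1 ∧ ⋯ ∧
e_r` is a cycle over `I₀` which bounds nothing over `I₀`; its bidegree `(r - 1, s + r)` contributes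
`s + 1`.

For `I₀ = I_i`, `I₁ = I_{i+1}`, `Q = Q_i`, irredundance puts the socle monomial of `Q_i` in
`I_{i+1}`, and `a_{ij} ≥ a_{i+1,j}` makes the socle degrees decrease in `i`, so the bound for
`I_{i+1}` never exceeds that for `I_i`. The ideal `Q_i` itself is the case `I₁ = S`. -/

/-- The sum of the terms of a polynomial whose exponents satisfy a predicate. -/
noncomputable def termsOf (P : (Fin n →₀ ℕ) → Prop) [DecidablePred P] (f : MvPolynomial (Fin n) K) :
    MvPolynomial (Fin n) K :=
  ∑ u ∈ f.support.filter P, monomial u (coeff u f)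

theorem coeff_termsOf (P : (Fin n →₀ ℕ) → Prop) [DecidablePred P] (f : MvPolynomial (Fin n) K)
    (u : Fin n →₀ ℕ) : coeff u (termsOf P f) = if P u then coeff u f else 0 := by
  classical
  simp only [termsOf, coeff_sum, coeff_monomial, Finset.sum_ite_eq', Finset.mem_filter,
    mem_support_iff]
  split_ifs <;> simp_all

/-- The component of degree `j` of an element of the free module with basis elements of
degree `c + deg l`. -/
noncomputable def gradedPart (deg : ι → ℕ) (c j : ℕ) :
    (ι → MvPolynomial (Fin n) K) →+ (ι → MvPolynomial (Fin n) K) where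
  toFun m l := termsOf (fun u => c + deg l + u.degree = j) (m l)
  map_zero' := by
    ext l u
    simp [coeff_termsOf]
  map_add' x y := by
    ext l u
    simp only [coeff_termsOf, Pi.add_apply, coeff_add]
    split_ifs <;> simp

theorem coeff_gradedPart (deg : ι → ℕ) (c j : ℕ) (m : ι → MvPolynomial (Fin n) K) (l : ι)
    (u : Fin n →₀ ℕ) : coeff u (gradedPart deg c j m l) =
      if c + deg l + u.degree = j then coeff u (m l) else 0 :=
  coeff_termsOf _ _ _

/-- The offset `c` will be the homological degree: a Koszul differential trades one basis element of
degree one for one factor `X k`, so the internal degree `j` is unchanged. -/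
theorem X_smul_gradedPart (deg : ι → ℕ) (c j : ℕ) (k : Fin n) (m : ι → MvPolynomial (Fin n) K) :
    (X k : MvPolynomial (Fin n) K) • gradedPart deg (c + 1) j m =
      gradedPart deg c j ((X k : MvPolynomial (Fin n) K) • m) := by
  ext l u
  simp only [coeff_gradedPart, Pi.smul_apply, smul_eq_mul, coeff_X_mul']
  by_cases hk : k ∈ u.support
  · have hu : u.degree = (u - Finsupp.single k 1).degree + 1 := by
      have h : u - Finsupp.single k 1 + Finsupp.single k 1 = u :=
        tsub_add_cancel_of_le (by
          rw [Finsupp.single_le_iff]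
          exact Nat.one_le_iff_ne_zero.2 (Finsupp.mem_support_iff.1 hk))
      conv_lhs => rw [← h]
      simp
    simp only [hk, if_true, hu]
    congr 1
    simp only [eq_iff_iff]
    omega
  · simp [hk]

/-- A linear map of graded free modules is homogeneous of degree `0`. -/
def IsHomogeneousMap (deg' : κ → ℕ) (deg : ι → ℕ) [DecidableEq κ]
    (f : (κ → MvPolynomial (Fin n) K) →ₗ[MvPolynomial (Fin n) K] (ι → MvPolynomial (Fin n) K)) :
    Prop :=
  ∀ k l, ∀ u ∈ (f (Pi.single k 1) l).support, u.degree + deg l = deg' k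

theorem linearMap_apply_eq_sum [Fintype κ] [DecidableEq κ]
    (f : (κ → MvPolynomial (Fin n) K) →ₗ[MvPolynomial (Fin n) K] (ι → MvPolynomial (Fin n) K))
    (m : κ → MvPolynomial (Fin n) K) (l : ι) :
    f m l = ∑ k, m k * f (Pi.single k 1) l := by
  conv_lhs => rw [← LinearMap.sum_single_apply (fun _ => MvPolynomial (Fin n) K) m]
  rw [map_sum, Finset.sum_apply]
  refine Finset.sum_congr rfl fun k _ => ?_
  have : Pi.single k (m k) = m k • (Pi.single k 1 : κ → MvPolynomial (Fin n) K) := by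
    rw [← Pi.single_smul, smul_eq_mul, mul_one]
  rw [this, map_smul, Pi.smul_apply, smul_eq_mul]

theorem IsHomogeneousMap.map_gradedPart [Fintype κ] [DecidableEq κ] {deg' : κ → ℕ} {deg : ι → ℕ}
    {f : (κ → MvPolynomial (Fin n) K) →ₗ[MvPolynomial (Fin n) K] (ι → MvPolynomial (Fin n) K)}
    (hf : IsHomogeneousMap deg' deg f) (c j : ℕ) (m : κ → MvPolynomial (Fin n) K) :
    f (gradedPart deg' c j m) = gradedPart deg c j (f m) := by
  ext l u
  have key : ∀ k, coeff u (gradedPart deg' c j m k * f (Pi.single k 1) l) =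
      if c + deg l + u.degree = j then coeff u (m k * f (Pi.single k 1) l) else 0 := by
    intro k
    rw [coeff_mul, coeff_mul]
    trans ∑ x ∈ Finset.HasAntidiagonal.antidiagonal u, if c + deg l + u.degree = j then
      coeff x.1 (m k) * coeff x.2 (f (Pi.single k 1) l) else 0
    swap
    · split_ifs <;> simp
    refine Finset.sum_congr rfl fun x hx => ?_
    rw [Finset.HasAntidiagonal.mem_antidiagonal] at hx
    rw [coeff_gradedPart]
    by_cases hy : coeff x.2 (f (Pi.single k 1) l) = 0
    · simp [hy]
    · have h1 := hf k l x.2 (mem_support_iff.2 hy)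
      have h2 : u.degree = x.1.degree + x.2.degree := by rw [← hx, map_add]
      by_cases h : c + deg l + u.degree = j
      · rw [if_pos (by omega), if_pos h]
      · rw [if_neg (by omega), if_neg h, zero_mul]
  rw [coeff_gradedPart, linearMap_apply_eq_sum, linearMap_apply_eq_sum, coeff_sum, coeff_sum]
  simp only [key]
  split_ifs <;> simp

/-! ### The Koszul complex -/

/-- The sign of `k` relative to the set `A` in the Koszul differential. -/
def koszulSign (k : Fin n) (A : Finset (Fin n)) : ℤ :=
  (-1) ^ (A.filter (· < k)).card

theorem koszulSign_mul_self (k : Fin n) (A : Finset (Fin n)) :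
    koszulSign k A * koszulSign k A = 1 := by
  rw [koszulSign, ← pow_add, ← two_mul, pow_mul]
  simp

theorem koszulSign_insert_of_lt {k l : Fin n} {A : Finset (Fin n)} (hk : k ∉ A) (h : k < l) :
    koszulSign l (insert k A) = -koszulSign l A := by
  rw [koszulSign, koszulSign, Finset.filter_insert, if_pos h, Finset.card_insert_of_notMem
    (fun h' => hk (Finset.mem_filter.1 h').1), pow_succ]
  simp

theorem koszulSign_insert_of_not_lt {k l : Fin n} {A : Finset (Fin n)} (h : ¬ k < l) :
    koszulSign l (insert k A) = koszulSign l A := by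
  rw [koszulSign, koszulSign, Finset.filter_insert, if_neg h]

/-- The sign rule behind `d ∘ d = 0`. -/
theorem koszulSign_swap {k l : Fin n} {A : Finset (Fin n)} (hk : k ∉ A) (hl : l ∉ A)
    (hkl : k ≠ l) :
    koszulSign k A * koszulSign l (insert k A) = -(koszulSign l A * koszulSign k (insert l A)) := by
  rcases lt_or_gt_of_ne hkl with h | h
  · rw [koszulSign_insert_of_lt hk h, koszulSign_insert_of_not_lt h.asymm]
    ring
  · rw [koszulSign_insert_of_lt hl h, koszulSign_insert_of_not_lt h.asymm]
    ring

/-- The sign rule by which division by one variable anticommutes with the terms of the differential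
belonging to the other variables. -/
theorem koszulSign_homotopy {k l : Fin n} {A : Finset (Fin n)} (hk : k ∉ A) (hl : l ∉ A)
    (hkl : k ≠ l) :
    koszulSign l (insert k A) * koszulSign k (insert l A) = -(koszulSign k A * koszulSign l A) := by
  rcases lt_or_gt_of_ne hkl with h | h
  · rw [koszulSign_insert_of_lt hk h, koszulSign_insert_of_not_lt h.asymm]
    ring
  · rw [koszulSign_insert_of_lt hl h, koszulSign_insert_of_not_lt h.asymm]
    ring

/-- The chains of the Koszul complex of the variables with coefficients in `M`: the value at `A`
is the coefficient of the wedge product of the basis elements indexed by `A`. -/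
abbrev KoszulChain (n : ℕ) (M : Type*) := Finset (Fin n) → M

section Differential

variable {M M' : Type*} [AddCommGroup M] [Module (MvPolynomial (Fin n) K) M]
  [AddCommGroup M'] [Module (MvPolynomial (Fin n) K) M']

/-- The Koszul differential. -/
noncomputable def koszulD (K : Type*) [Field K] {n : ℕ} {M : Type*} [AddCommGroup M]
    [Module (MvPolynomial (Fin n) K) M] : KoszulChain n M →+ KoszulChain n M where
  toFun z A := ∑ k ∈ Aᶜ, koszulSign k A • (X k : MvPolynomial (Fin n) K) • z (insert k A)
  map_zero' := by
    ext A
    simp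
  map_add' x y := by
    ext A
    simp [Finset.sum_add_distrib]

theorem koszulD_apply (z : KoszulChain n M) (A : Finset (Fin n)) : koszulD K z A =
    ∑ k ∈ Aᶜ, koszulSign k A • (X k : MvPolynomial (Fin n) K) • z (insert k A) :=
  rfl

theorem koszulD_koszulD (z : KoszulChain n M) : koszulD K (koszulD K z) = 0 := by
  ext A
  simp only [koszulD_apply, Finset.smul_sum, Pi.zero_apply]
  rw [Finset.sum_sigma']
  -- Removing `k` and then `l` cancels against removing `l` and then `k`.
  refine Finset.sum_involution (fun p _ => ⟨p.2, p.1⟩) ?_ ?_ ?_ ?_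
  · rintro ⟨k, l⟩ h
    simp only [Finset.mem_sigma, Finset.mem_compl, Finset.mem_insert, not_or] at h
    obtain ⟨hk, hlk, hl⟩ := h
    dsimp only
    rw [Finset.insert_comm l k]
    have e : ∀ (s t : ℤ) (p q : MvPolynomial (Fin n) K) (m : M),
        s • p • t • q • m = (s * t) • (p * q) • m := by
      intro s t p q m
      rw [smul_comm p t, smul_smul, smul_smul]
    rw [e, e, mul_comm (X l) (X k), ← add_smul, koszulSign_swap hk hl (Ne.symm hlk)]
    simp
  · rintro ⟨k, l⟩ h _ heq
    simp only [Finset.mem_sigma, Finset.mem_compl, Finset.mem_insert, not_or] at h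
    simp only [Sigma.mk.injEq] at heq
    exact h.2.1 heq.1
  · rintro ⟨k, l⟩ h
    simp only [Finset.mem_sigma, Finset.mem_compl, Finset.mem_insert, not_or] at h ⊢
    exact ⟨h.2.2, Ne.symm h.2.1, h.1⟩
  · rintro ⟨k, l⟩ h
    rfl

theorem koszulD_mem {B : Submodule (MvPolynomial (Fin n) K) M} {z : KoszulChain n M}
    (hz : ∀ A, z A ∈ B) (A : Finset (Fin n)) : koszulD K z A ∈ B :=
  Submodule.sum_mem _ fun _ _ => B.toAddSubgroup.zsmul_mem (B.smul_mem _ (hz _)) _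

theorem koszulD_comp (f : M →ₗ[MvPolynomial (Fin n) K] M') (z : KoszulChain n M) :
    koszulD K (fun A => f (z A)) = fun A => f (koszulD K z A) := by
  ext A
  simp only [koszulD_apply, map_sum, map_zsmul, map_smul]

end Differential

/-! ### Bihomogeneous chains -/

/-- A Koszul chain with coefficients in a graded free module is bihomogeneous of homological
degree `p` and internal degree `j`. -/
def Bihomogeneous (deg : ι → ℕ) (p j : ℕ) (z : KoszulChain n (ι → MvPolynomial (Fin n) K)) :
    Prop :=
  ∀ A l u, coeff u (z A l) ≠ 0 → A.card = p ∧ p + deg l + u.degree = j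

/-- The bihomogeneous component of a Koszul chain. -/
noncomputable def bihomPart (deg : ι → ℕ) (p j : ℕ)
    (z : KoszulChain n (ι → MvPolynomial (Fin n) K)) :
    KoszulChain n (ι → MvPolynomial (Fin n) K) :=
  fun A => if A.card = p then gradedPart deg p j (z A) else 0

theorem coeff_bihomPart (deg : ι → ℕ) (p j : ℕ)
    (z : KoszulChain n (ι → MvPolynomial (Fin n) K)) (A : Finset (Fin n)) (l : ι)
    (u : Fin n →₀ ℕ) : coeff u (bihomPart deg p j z A l) =
      if A.card = p ∧ p + deg l + u.degree = j then coeff u (z A l) else 0 := by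
  rw [bihomPart]
  by_cases h : A.card = p
  · rw [if_pos h, coeff_gradedPart]
    simp [h]
  · simp [h]

theorem bihomogeneous_bihomPart (deg : ι → ℕ) (p j : ℕ)
    (z : KoszulChain n (ι → MvPolynomial (Fin n) K)) :
    Bihomogeneous deg p j (bihomPart deg p j z) := by
  intro A l u h
  rw [coeff_bihomPart] at h
  by_contra h'
  exact h (if_neg h')

theorem Bihomogeneous.bihomPart_eq {deg : ι → ℕ} {p j : ℕ}
    {z : KoszulChain n (ι → MvPolynomial (Fin n) K)} (hz : Bihomogeneous deg p j z) :
    bihomPart deg p j z = z := by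
  ext A l u
  rw [coeff_bihomPart]
  split_ifs with h
  · rfl
  · by_contra h'
    exact h (hz A l u (Ne.symm h'))

theorem Bihomogeneous.eq_zero {deg : ι → ℕ} {p j : ℕ}
    {z : KoszulChain n (ι → MvPolynomial (Fin n) K)} (hz : Bihomogeneous deg p j z)
    {A : Finset (Fin n)} (hA : A.card ≠ p) : z A = 0 := by
  ext l u
  by_contra h
  exact hA (hz A l u h).1

theorem koszulD_bihomPart (deg : ι → ℕ) (p j : ℕ)
    (z : KoszulChain n (ι → MvPolynomial (Fin n) K)) :
    koszulD K (bihomPart deg (p + 1) j z) = bihomPart deg p j (koszulD K z) := by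
  funext A
  rw [koszulD_apply]
  by_cases h : A.card = p
  · rw [bihomPart, if_pos h, koszulD_apply, map_sum]
    refine Finset.sum_congr rfl fun k hk => ?_
    rw [bihomPart, if_pos (by rw [Finset.card_insert_of_notMem (Finset.mem_compl.1 hk), h]),
      X_smul_gradedPart, map_zsmul]
  · rw [bihomPart, if_neg h]
    refine Finset.sum_eq_zero fun k hk => ?_
    rw [bihomPart, if_neg (by
      rw [Finset.card_insert_of_notMem (Finset.mem_compl.1 hk)]
      omega), smul_zero, smul_zero]

theorem Bihomogeneous.koszulD {deg : ι → ℕ} {p j : ℕ}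
    {z : KoszulChain n (ι → MvPolynomial (Fin n) K)} (hz : Bihomogeneous deg (p + 1) j z) :
    Bihomogeneous deg p j (koszulD K z) := by
  rw [← hz.bihomPart_eq, koszulD_bihomPart]
  exact bihomogeneous_bihomPart _ _ _ _

theorem Bihomogeneous.koszulD_eq_zero {deg : ι → ℕ} {j : ℕ}
    {z : KoszulChain n (ι → MvPolynomial (Fin n) K)} (hz : Bihomogeneous deg 0 j z) :
    BorelType.koszulD K z = 0 := by
  funext A
  rw [koszulD_apply]
  refine Finset.sum_eq_zero fun k hk => ?_
  rw [hz.eq_zero (by simp), smul_zero, smul_zero]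

theorem bihomPart_comp [Fintype κ] [DecidableEq κ] {deg' : κ → ℕ} {deg : ι → ℕ}
    {f : (κ → MvPolynomial (Fin n) K) →ₗ[MvPolynomial (Fin n) K] (ι → MvPolynomial (Fin n) K)}
    (hf : IsHomogeneousMap deg' deg f) (p j : ℕ)
    (z : KoszulChain n (κ → MvPolynomial (Fin n) K)) :
    bihomPart deg p j (fun A => f (z A)) = fun A => f (bihomPart deg' p j z A) := by
  funext A
  rw [bihomPart, bihomPart]
  split_ifs
  · rw [hf.map_gradedPart]
  · rw [map_zero]

theorem Bihomogeneous.comp [Fintype κ] [DecidableEq κ] {deg' : κ → ℕ} {deg : ι → ℕ}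
    {f : (κ → MvPolynomial (Fin n) K) →ₗ[MvPolynomial (Fin n) K] (ι → MvPolynomial (Fin n) K)}
    (hf : IsHomogeneousMap deg' deg f) {p j : ℕ}
    {z : KoszulChain n (κ → MvPolynomial (Fin n) K)} (hz : Bihomogeneous deg' p j z) :
    Bihomogeneous deg p j (fun A => f (z A)) := by
  rw [← hz.bihomPart_eq, ← bihomPart_comp hf]
  exact bihomogeneous_bihomPart _ _ _ _

/-! ### Contracting homotopies of the Koszul complex -/

/-- Division of every entry by the variable `X k`, discarding the terms not divisible by it. -/
noncomputable def divVar (k : Fin n) :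
    (ι → MvPolynomial (Fin n) K) →+ (ι → MvPolynomial (Fin n) K) where
  toFun m l := (m l).divMonomial (Finsupp.single k 1)
  map_zero' := by
    ext l u
    simp
  map_add' x y := by
    ext l u
    simp [add_divMonomial]

/-- The terms of every entry which are not divisible by the variable `X k`. -/
noncomputable def modVar (k : Fin n) (m : ι → MvPolynomial (Fin n) K) :
    ι → MvPolynomial (Fin n) K :=
  fun l => (m l).modMonomial (Finsupp.single k 1)

theorem coeff_modVar (k : Fin n) (m : ι → MvPolynomial (Fin n) K) (l : ι) (u : Fin n →₀ ℕ) :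
    coeff u (modVar k m l) = if u k = 0 then coeff u (m l) else 0 := by
  rw [modVar]
  split_ifs with h
  · exact coeff_modMonomial_of_not_le _ (by simp [Finsupp.single_le_iff, h])
  · exact coeff_modMonomial_of_le _ (by
      rw [Finsupp.single_le_iff]
      omega)

theorem X_smul_divVar_add_modVar (k : Fin n) (m : ι → MvPolynomial (Fin n) K) :
    (X k : MvPolynomial (Fin n) K) • divVar k m + modVar k m = m := by
  funext l
  exact divMonomial_add_modMonomial_single (m l) k

theorem divVar_X_smul (k : Fin n) (m : ι → MvPolynomial (Fin n) K) :
    divVar k ((X k : MvPolynomial (Fin n) K) • m) = m := by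
  funext l
  exact X_mul_divMonomial k (m l)

theorem divVar_X_smul_of_ne {k l : Fin n} (h : k ≠ l) (m : ι → MvPolynomial (Fin n) K) :
    divVar k ((X l : MvPolynomial (Fin n) K) • m) =
      (X l : MvPolynomial (Fin n) K) • divVar k m := by
  ext i u
  change coeff u ((X l * m i).divMonomial _) = coeff u (X l * (m i).divMonomial _)
  have h1 : (Finsupp.single k 1 + u : Fin n →₀ ℕ) l = u l := by
    simp [h]
  rw [coeff_divMonomial, coeff_X_mul', coeff_X_mul']
  simp only [Finsupp.mem_support_iff, h1]
  split_ifs with hl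
  · rw [coeff_divMonomial, add_tsub_assoc_of_le]
    rw [Finsupp.single_le_iff]
    omega
  · rfl

/-- The homotopy of the Koszul complex given by division by the variable `X k`. -/
noncomputable def koszulHomotopy (k : Fin n) (z : KoszulChain n (ι → MvPolynomial (Fin n) K)) :
    KoszulChain n (ι → MvPolynomial (Fin n) K) :=
  fun A => if k ∈ A then koszulSign k (A.erase k) • divVar k (z (A.erase k)) else 0

/-- The part of a Koszul chain which does not involve the variable `X k`. -/
noncomputable def omitVar (k : Fin n) (z : KoszulChain n (ι → MvPolynomial (Fin n) K)) :
    KoszulChain n (ι → MvPolynomial (Fin n) K) :=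
  fun A => if k ∈ A then 0 else modVar k (z A)

theorem coeff_omitVar (k : Fin n) (z : KoszulChain n (ι → MvPolynomial (Fin n) K))
    (A : Finset (Fin n)) (l : ι) (u : Fin n →₀ ℕ) :
    coeff u (omitVar k z A l) = if k ∉ A ∧ u k = 0 then coeff u (z A l) else 0 := by
  rw [omitVar]
  by_cases h : k ∈ A
  · simp [h]
  · simp [h, coeff_modVar]

/-- The identity `dh + hd = id - π`. In the direction of `k` the complex is multiplication by `X k`,
which division inverts up to the terms not divisible by `X k`; division commutes with every other
variable, so the remaining terms of `dh` and `hd` cancel by sign. -/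
theorem koszulHomotopy_spec (k : Fin n) (z : KoszulChain n (ι → MvPolynomial (Fin n) K)) :
    koszulD K (koszulHomotopy k z) + koszulHomotopy k (koszulD K z) + omitVar k z = z := by
  funext A
  simp only [Pi.add_apply]
  by_cases hk : k ∈ A
  · obtain ⟨B, hB, rfl⟩ : ∃ B, k ∉ B ∧ A = insert k B :=
      ⟨A.erase k, Finset.notMem_erase k A, (Finset.insert_erase hk).symm⟩
    have hc : Bᶜ = insert k (insert k B)ᶜ := by
      ext x
      by_cases hx : x = k <;> simp [hx, hB]
    have h1 : koszulHomotopy k (koszulD K z) (insert k B) = z (insert k B) +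
        ∑ l ∈ (insert k B)ᶜ, (koszulSign k B * koszulSign l B) •
          (X l : MvPolynomial (Fin n) K) • divVar k (z (insert l B)) := by
      rw [koszulHomotopy, if_pos hk, Finset.erase_insert hB, koszulD_apply, hc,
        Finset.sum_insert (by simp), map_add, map_sum, smul_add, map_zsmul, divVar_X_smul,
        smul_smul, koszulSign_mul_self, one_smul, Finset.smul_sum]
      congr 1
      refine Finset.sum_congr rfl fun l hl => ?_
      rw [map_zsmul, divVar_X_smul_of_ne, smul_smul]
      rintro rfl
      simp at hl
    have h2 : koszulD K (koszulHomotopy k z) (insert k B) =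
        ∑ l ∈ (insert k B)ᶜ, -((koszulSign k B * koszulSign l B) •
          (X l : MvPolynomial (Fin n) K) • divVar k (z (insert l B))) := by
      rw [koszulD_apply]
      refine Finset.sum_congr rfl fun l hl => ?_
      simp only [Finset.mem_compl, Finset.mem_insert, not_or] at hl
      have hkl : k ∉ insert l B := by simp [hB, Ne.symm hl.1]
      rw [koszulHomotopy, if_pos (by simp), Finset.insert_comm l k, Finset.erase_insert hkl,
        smul_comm (X l : MvPolynomial (Fin n) K), smul_smul,
        koszulSign_homotopy hB hl.2 (Ne.symm hl.1), neg_smul]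
    rw [h1, h2, omitVar, if_pos hk, Finset.sum_neg_distrib]
    abel
  · have h1 : koszulHomotopy k (koszulD K z) A = 0 := if_neg hk
    have h2 : koszulD K (koszulHomotopy k z) A =
        (X k : MvPolynomial (Fin n) K) • divVar k (z A) := by
      rw [koszulD_apply, Finset.sum_eq_single k]
      · rw [koszulHomotopy, if_pos (by simp), Finset.erase_insert hk,
          smul_comm (X k : MvPolynomial (Fin n) K), smul_smul, koszulSign_mul_self, one_smul]
      · intro l _ hl
        rw [koszulHomotopy, if_neg (by simp [hk, Ne.symm hl]), smul_zero, smul_zero]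
      · intro h
        exact absurd (Finset.mem_compl.2 hk) h
    rw [h1, h2, omitVar, if_neg hk, add_zero, X_smul_divVar_add_modVar]

theorem koszulHomotopy_mem {B : Submodule (MvPolynomial (Fin n) K) (ι → MvPolynomial (Fin n) K)}
    {k : Fin n} (hB : ∀ m ∈ B, divVar k m ∈ B)
    {z : KoszulChain n (ι → MvPolynomial (Fin n) K)} (hz : ∀ A, z A ∈ B) (A : Finset (Fin n)) :
    koszulHomotopy k z A ∈ B := by
  rw [koszulHomotopy]
  split_ifs
  · exact B.toAddSubgroup.zsmul_mem (hB _ (hz _)) _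
  · exact B.zero_mem

/-- A relative cycle is homologous to one which does not involve the variables in `T`, provided
that the two modules are stable under division by these variables. -/
theorem exists_reduction (T : Finset (Fin n))
    {J J' : Submodule (MvPolynomial (Fin n) K) (ι → MvPolynomial (Fin n) K)} (hJ : J' ≤ J)
    (hD : ∀ k ∈ T, ∀ m ∈ J, divVar k m ∈ J) (hD' : ∀ k ∈ T, ∀ m ∈ J', divVar k m ∈ J')
    {z : KoszulChain n (ι → MvPolynomial (Fin n) K)} (hz : ∀ A, z A ∈ J)
    (hdz : ∀ A, koszulD K z A ∈ J') :
    ∃ v w : KoszulChain n (ι → MvPolynomial (Fin n) K), (∀ A, v A ∈ J) ∧ (∀ A, w A ∈ J) ∧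
      (∀ A, (z - koszulD K v - w) A ∈ J') ∧
      ∀ A l u, coeff u (w A l) ≠ 0 → coeff u (z A l) ≠ 0 ∧ ∀ k ∈ T, k ∉ A ∧ u k = 0 := by
  induction T using Finset.induction_on with
  | empty => exact ⟨0, z, fun _ => J.zero_mem, hz, by simp, fun A l u h => ⟨h, by simp⟩⟩
  | insert k T _ ih =>
    obtain ⟨v, w, hv, hw, hvw, hsupp⟩ := ih (fun k hk => hD k (Finset.mem_insert_of_mem hk))
      (fun k hk => hD' k (Finset.mem_insert_of_mem hk))
    have hk := Finset.mem_insert_self k T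
    have hdw : ∀ A, koszulD K w A ∈ J' := by
      intro A
      have h : koszulD K w = koszulD K z - koszulD K (z - koszulD K v - w) := by
        rw [map_sub, map_sub, koszulD_koszulD]
        abel
      rw [h]
      exact J'.sub_mem (hdz A) (koszulD_mem hvw A)
    -- In `w = d(hw) + h(dw) + omitVar k w` the first term is absorbed into `v`, and the second lies
    -- in `J'` because `dw` does and `J'` is stable under division by `X k`.
    have hspec := koszulHomotopy_spec k w
    have hhd := koszulHomotopy_mem (hD' k hk) hdw
    have hh := koszulHomotopy_mem (hD k hk) hw
    refine ⟨v + koszulHomotopy k w, omitVar k w, fun A => J.add_mem (hv A) (hh A), fun A => ?_,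
      fun A => ?_, fun A l u h => ?_⟩
    · have h : omitVar k w =
          w - koszulD K (koszulHomotopy k w) - koszulHomotopy k (koszulD K w) := by
        nth_rewrite 2 [← hspec]
        abel
      rw [h]
      exact J.sub_mem (J.sub_mem (hw A) (koszulD_mem hh A)) (hJ (hhd A))
    · have h : z - koszulD K (v + koszulHomotopy k w) - omitVar k w =
          (z - koszulD K v - w) + koszulHomotopy k (koszulD K w) := by
        nth_rewrite 3 [← hspec]
        rw [map_add]
        abel
      rw [h]
      exact J'.add_mem (hvw A) (hhd A)
    · rw [coeff_omitVar] at h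
      split_ifs at h with hc
      · obtain ⟨h1, h2⟩ := hsupp A l u h
        refine ⟨h1, fun x hx => ?_⟩
        rcases Finset.mem_insert.1 hx with rfl | hx
        · exact hc
        · exact h2 x hx
      · exact absurd rfl h

/-- A Koszul cycle of a free module is a boundary if it has no constant term in homological
degree zero. -/
theorem exists_koszulD_eq {z : KoszulChain n (ι → MvPolynomial (Fin n) K)}
    (hz : koszulD K z = 0) (hz0 : ∀ l, constantCoeff (z ∅ l) = 0) :
    ∃ w, koszulD K w = z := by
  -- Reducing along all the variables leaves only the constant term at `A = ∅`.
  obtain ⟨v, w, -, -, hvw, hsupp⟩ := exists_reduction (J := ⊤) (J' := ⊥) Finset.univ bot_le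
    (by simp) (by
      intro k _ m hm
      rw [Submodule.mem_bot] at hm
      simp [hm]) (z := z) (by simp) (by simp [hz])
  have hw : w = 0 := by
    ext A l u
    by_contra h
    obtain ⟨h1, h2⟩ := hsupp A l u h
    have hA : A = ∅ := Finset.eq_empty_of_forall_notMem fun k => (h2 k (Finset.mem_univ k)).1
    have hu : u = 0 := Finsupp.ext fun k => (h2 k (Finset.mem_univ k)).2
    subst hA hu
    exact h1 (hz0 l)
  refine ⟨v, ?_⟩
  funext A
  have h := hvw A
  rw [hw, sub_zero, Submodule.mem_bot, Pi.sub_apply, sub_eq_zero] at h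
  exact h.symm

/-! ### Koszul homology and minimal resolutions -/

/-- Vanishing of the Koszul homology of a submodule of a graded free module in homological
degree `p` and internal degree `j`. -/
def KoszulAcyclic (deg : ι → ℕ)
    (B : Submodule (MvPolynomial (Fin n) K) (ι → MvPolynomial (Fin n) K)) (p j : ℕ) : Prop :=
  ∀ z : KoszulChain n (ι → MvPolynomial (Fin n) K), (∀ A, z A ∈ B) → Bihomogeneous deg p j z →
    koszulD K z = 0 → ∃ w, (∀ A, w A ∈ B) ∧ koszulD K w = z

/-- All entries of the elements of the submodule lie in the ideal of the variables. -/
def NoConstantTerm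
    (B : Submodule (MvPolynomial (Fin n) K) (ι → MvPolynomial (Fin n) K)) : Prop :=
  ∀ m ∈ B, ∀ l, constantCoeff (m l) = 0

/-- A homogeneous element defines a bihomogeneous chain in homological degree zero. -/
theorem bihomogeneous_single {deg : ι → ℕ} {j : ℕ} {m : ι → MvPolynomial (Fin n) K}
    (hm : ∀ l u, coeff u (m l) ≠ 0 → deg l + u.degree = j) :
    Bihomogeneous deg 0 j (Pi.single ∅ m : KoszulChain n (ι → MvPolynomial (Fin n) K)) := by
  intro A l u h
  by_cases hA : A = ∅
  · subst hA
    rw [Pi.single_eq_same] at h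
    exact ⟨rfl, by rw [zero_add, hm l u h]⟩
  · simp [Pi.single_eq_of_ne hA] at h

section Step

variable [Fintype κ] [DecidableEq κ] {deg' : κ → ℕ} {deg : ι → ℕ}
  {f : (κ → MvPolynomial (Fin n) K) →ₗ[MvPolynomial (Fin n) K] (ι → MvPolynomial (Fin n) K)}

/-- Half of the connecting isomorphism `H_{p+1}(range f) ≅ H_p(ker f)`. A cycle over `ker f` bounds
some `w` over the free module, minimality excluding the obstruction by constants. Then `f w` is a
cycle over `range f`; writing it as `d (f v')` allows `w` to be corrected by `d v'` into `ker f`. -/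
theorem KoszulAcyclic.ker_of_range (hf : IsHomogeneousMap deg' deg f)
    (hmin : NoConstantTerm (LinearMap.ker f)) {p j : ℕ}
    (h : KoszulAcyclic deg (LinearMap.range f) (p + 1) j) :
    KoszulAcyclic deg' (LinearMap.ker f) p j := by
  intro z hz hzb hdz
  obtain ⟨w₀, hw₀⟩ := exists_koszulD_eq hdz (hmin _ (hz ∅))
  have hw : koszulD K (bihomPart deg' (p + 1) j w₀) = z := by
    rw [koszulD_bihomPart, hw₀, hzb.bihomPart_eq]
  have hwb := bihomogeneous_bihomPart deg' (p + 1) j w₀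
  set w := bihomPart deg' (p + 1) j w₀
  obtain ⟨v, hv, hdv⟩ := h (fun A => f (w A)) (fun A => LinearMap.mem_range_self f _)
    (hwb.comp hf) (by
      rw [koszulD_comp, hw]
      exact funext fun A => LinearMap.mem_ker.1 (hz A))
  choose v' hv' using hv
  refine ⟨w - koszulD K v', fun A => ?_, ?_⟩
  · rw [LinearMap.mem_ker, Pi.sub_apply, map_sub, sub_eq_zero]
    have h1 : koszulD K (fun A => f (v' A)) = fun A => f (w A) := by
      rw [← hdv]
      congr 1
      exact funext hv'
    rw [koszulD_comp] at h1
    exact (congrFun h1 A).symm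
  · rw [map_sub, koszulD_koszulD, sub_zero, hw]

/-- The other half of the connecting isomorphism. Lift the cycle to `w`; then `dw` is a cycle over
`ker f`, so it equals `dv` with `v` over `ker f`, and `w - v` bounds. Minimality is not needed: `w -
v` has positive homological degree, hence no entry at `∅`. -/
theorem KoszulAcyclic.range_of_ker (hf : IsHomogeneousMap deg' deg f) {p j : ℕ}
    (h : KoszulAcyclic deg' (LinearMap.ker f) p j) :
    KoszulAcyclic deg (LinearMap.range f) (p + 1) j := by
  intro z hz hzb hdz
  choose w₀ hw₀ using hz
  have hw : (fun A => f (bihomPart deg' (p + 1) j w₀ A)) = z := by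
    rw [← bihomPart_comp hf, funext hw₀, hzb.bihomPart_eq]
  have hwb := bihomogeneous_bihomPart deg' (p + 1) j w₀
  set w := bihomPart deg' (p + 1) j w₀
  obtain ⟨v₀, hv₀, hdv₀⟩ := h (koszulD K w) (fun A => by
      rw [LinearMap.mem_ker]
      have := congrFun (koszulD_comp f w) A
      rw [hw, hdz] at this
      exact this.symm) hwb.koszulD (koszulD_koszulD w)
  have hfv : (fun A => f (bihomPart deg' (p + 1) j v₀ A)) = 0 := by
    rw [← bihomPart_comp hf, funext fun A => LinearMap.mem_ker.1 (hv₀ A)]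
    funext A
    simp [bihomPart]
  have hdv : koszulD K (bihomPart deg' (p + 1) j v₀) = koszulD K w := by
    rw [koszulD_bihomPart, hdv₀, hwb.koszulD.bihomPart_eq]
  have hvb := bihomogeneous_bihomPart deg' (p + 1) j v₀
  set v := bihomPart deg' (p + 1) j v₀
  obtain ⟨u, hu⟩ := exists_koszulD_eq (z := w - v) (by rw [map_sub, hdv, sub_self]) (by
    intro l
    rw [Pi.sub_apply, hwb.eq_zero (by simp), hvb.eq_zero (by simp)]
    simp)
  refine ⟨fun A => f (u A), fun A => LinearMap.mem_range_self f _, ?_⟩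
  rw [koszulD_comp, hu, ← hw]
  funext A
  have := congrFun hfv A
  simp only [Pi.zero_apply] at this
  rw [Pi.sub_apply, map_sub, this, sub_zero]

/-- Nakayama: `H_0` of `range f` is its quotient by the multiples of the variables, and by
minimality the images of the basis elements form a basis of that quotient over `K`. -/
theorem koszulAcyclic_range_zero_iff (hf : IsHomogeneousMap deg' deg f)
    (hmin : NoConstantTerm (LinearMap.ker f)) {j : ℕ} :
    KoszulAcyclic deg (LinearMap.range f) 0 j ↔ ∀ k, deg' k ≠ j := by
  constructor
  · rintro h k rfl
    have hb : Bihomogeneous deg 0 (deg' k)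
        (Pi.single ∅ (f (Pi.single k 1)) : KoszulChain n (ι → MvPolynomial (Fin n) K)) :=
      bihomogeneous_single fun l u hu => by
        rw [add_comm]
        exact hf k l u (mem_support_iff.2 hu)
    obtain ⟨w, hw, hdw⟩ := h _ (fun A => by
      by_cases hA : A = ∅
      · subst hA
        rw [Pi.single_eq_same]
        exact LinearMap.mem_range_self f _
      · rw [Pi.single_eq_of_ne hA]
        exact Submodule.zero_mem _) hb hb.koszulD_eq_zero
    choose g hg using hw
    have h1 : f (koszulD K g ∅) = f (Pi.single k 1) := by
      have h2 := congrFun (koszulD_comp f g) ∅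
      rw [funext hg, hdw, Pi.single_eq_same] at h2
      exact h2.symm
    -- This element of `ker f` has constant term `-1` in its entry `k`, since a boundary has entries
    -- in the ideal of the variables.
    have h2 := hmin (koszulD K g ∅ - Pi.single k 1)
      (by rw [LinearMap.mem_ker, map_sub, h1, sub_self]) k
    rw [koszulD_apply, Pi.sub_apply, Finset.sum_apply, map_sub, map_sum, Pi.single_eq_same,
      map_one, sub_eq_zero, Finset.sum_eq_zero] at h2
    · exact zero_ne_one h2
    · intro l _
      simp
  · intro h z hz hzb _
    choose g₀ hg₀ using hz
    have hg : (fun A => f (bihomPart deg' 0 j g₀ A)) = z := by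
      rw [← bihomPart_comp hf, funext hg₀, hzb.bihomPart_eq]
    have hgb := bihomogeneous_bihomPart deg' 0 j g₀
    set g := bihomPart deg' 0 j g₀
    -- A nonzero constant term of `g` in the entry `k` would force `deg' k = j`.
    obtain ⟨w, hw⟩ := exists_koszulD_eq hgb.koszulD_eq_zero (by
      intro k
      by_contra h0
      refine h k ?_
      have := (hgb ∅ k 0 h0).2
      simpa using this)
    refine ⟨fun A => f (w A), fun A => LinearMap.mem_range_self f _, ?_⟩
    rw [koszulD_comp, hw, hg]

end Step

/-- In a minimal graded free complex which is exact, the degrees of the basis elements are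
detected by the Koszul homology of the augmented module. -/
theorem koszulAcyclic_range_iff (rank : ℕ → ℕ) (deg : (i : ℕ) → Fin (rank i) → ℕ)
    (f : (i : ℕ) → (Fin (rank (i + 1)) → MvPolynomial (Fin n) K) →ₗ[MvPolynomial (Fin n) K]
      (Fin (rank i) → MvPolynomial (Fin n) K))
    (hf : ∀ i, IsHomogeneousMap (deg (i + 1)) (deg i) (f i))
    (hmin : ∀ i, NoConstantTerm (LinearMap.ker (f i)))
    (hex : ∀ i, LinearMap.range (f (i + 1)) = LinearMap.ker (f i)) (p i j : ℕ) :
    KoszulAcyclic (deg i) (LinearMap.range (f i)) p j ↔ ∀ k, deg (p + i + 1) k ≠ j := by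
  -- Each dimension shift trades one homological degree for one step along the resolution.
  induction p generalizing i with
  | zero =>
    rw [zero_add]
    exact koszulAcyclic_range_zero_iff (hf i) (hmin i)
  | succ p ih =>
    have h := ih (i + 1)
    rw [hex, show p + (i + 1) = p + 1 + i by omega] at h
    rw [← h]
    exact ⟨fun h => h.ker_of_range (hf i) (hmin i), fun h => h.range_of_ker (hf i)⟩

/-- An ideal as a submodule of a free module of rank one. -/
noncomputable def idealSubmodule (I : Ideal (MvPolynomial (Fin n) K)) :
    Submodule (MvPolynomial (Fin n) K) (Fin 1 → MvPolynomial (Fin n) K) :=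
  Submodule.comap
    (LinearMap.proj 0 : (Fin 1 → MvPolynomial (Fin n) K) →ₗ[MvPolynomial (Fin n) K] _) I

theorem mem_idealSubmodule {I : Ideal (MvPolynomial (Fin n) K)}
    {m : Fin 1 → MvPolynomial (Fin n) K} : m ∈ idealSubmodule I ↔ m 0 ∈ I :=
  Iff.rfl

namespace MinimalGradedFreeResolution

variable {I : Ideal (MvPolynomial (Fin n) K)} (F : MinimalGradedFreeResolution I)

/-- The ranks of the resolution of `S / I`. -/
def augRank : ℕ → ℕ
  | 0 => 1
  | i + 1 => F.rank i

/-- The degrees of the resolution of `S / I`. -/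
def augDeg : (i : ℕ) → Fin (F.augRank i) → ℕ
  | 0 => fun _ => 0
  | i + 1 => F.deg i

/-- The differentials of the resolution of `S / I`. -/
noncomputable def augD : (i : ℕ) → (Fin (F.augRank (i + 1)) → MvPolynomial (Fin n) K)
    →ₗ[MvPolynomial (Fin n) K] (Fin (F.augRank i) → MvPolynomial (Fin n) K)
  | 0 => LinearMap.pi fun _ => F.aug
  | i + 1 => F.d i

theorem ker_augD_zero : LinearMap.ker (F.augD 0) = LinearMap.ker F.aug := by
  ext m
  constructor
  · intro h
    exact congrFun (LinearMap.mem_ker.1 h) (0 : Fin 1)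
  · intro h
    exact LinearMap.mem_ker.2 (funext fun _ => LinearMap.mem_ker.1 h)

theorem range_pi_aug :
    LinearMap.range (LinearMap.pi fun _ : Fin 1 => F.aug) = idealSubmodule I := by
  ext m
  have hI : m ∈ idealSubmodule I ↔ m 0 ∈ LinearMap.range F.aug := by
    rw [F.range_aug]
    rfl
  rw [hI]
  constructor
  · rintro ⟨x, rfl⟩
    exact ⟨x, rfl⟩
  · rintro ⟨x, hx⟩
    refine ⟨x, funext fun l => ?_⟩
    rw [Subsingleton.elim l (0 : Fin 1), ← hx]
    rfl

theorem noConstantTerm_range_d (i : ℕ) : NoConstantTerm (LinearMap.range (F.d i)) := by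
  rintro _ ⟨x, rfl⟩ l
  rw [linearMap_apply_eq_sum, map_sum]
  refine Finset.sum_eq_zero fun k _ => ?_
  rw [map_mul, F.minimal, mul_zero]

theorem range_augD_succ : ∀ i, LinearMap.range (F.augD (i + 1)) = LinearMap.ker (F.augD i)
  | 0 => F.exact_zero.trans F.ker_augD_zero.symm
  | i + 1 => F.exact_succ i

theorem isHomogeneousMap_augD :
    ∀ i, IsHomogeneousMap (F.augDeg (i + 1)) (F.augDeg i) (F.augD i)
  | 0 => fun k _ u hu => F.aug_homogeneous k u hu
  | i + 1 => fun k l u hu => F.d_homogeneous i k l u hu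

/-- The resolution is prolonged by `S` in position zero, which makes `I` the range of a map between
free modules; `koszulAcyclic_range_iff` applies there, and its index `p + 0 + 1` points to `F_p`. -/
theorem betti_ne_zero_iff (p j : ℕ) :
    F.betti p j ≠ 0 ↔ ¬ KoszulAcyclic (fun _ => 0) (idealSubmodule I) p j := by
  have h := koszulAcyclic_range_iff F.augRank F.augDeg F.augD F.isHomogeneousMap_augD
    (fun i => by
      rw [← F.range_augD_succ]
      exact F.noConstantTerm_range_d i) F.range_augD_succ p 0 j
  have h' : KoszulAcyclic (fun _ => 0) (idealSubmodule I) p j ↔ ∀ k, F.deg p k ≠ j := by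
    rw [← F.range_pi_aug]
    exact h
  rw [h', betti, Finset.card_ne_zero, Finset.filter_nonempty_iff]
  simp

end MinimalGradedFreeResolution

/-! ### Existence of minimal graded free resolutions -/

/-- A submodule of a graded free module is graded. -/
def IsGraded (deg : ι → ℕ)
    (B : Submodule (MvPolynomial (Fin n) K) (ι → MvPolynomial (Fin n) K)) : Prop :=
  ∀ c j, ∀ m ∈ B, gradedPart deg c j m ∈ B

/-- All terms of an element of a graded free module have degree `j`. -/
def IsHomogeneousElt (deg : ι → ℕ) (j : ℕ) (m : ι → MvPolynomial (Fin n) K) : Prop :=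
  ∀ l u, coeff u (m l) ≠ 0 → u.degree + deg l = j

theorem isHomogeneousElt_gradedPart (deg : ι → ℕ) (j : ℕ) (m : ι → MvPolynomial (Fin n) K) :
    IsHomogeneousElt deg j (gradedPart deg 0 j m) := by
  intro l u h
  rw [coeff_gradedPart] at h
  split_ifs at h with h'
  · omega
  · exact absurd rfl h

theorem exists_sum_gradedPart [Fintype ι] (deg : ι → ℕ) (m : ι → MvPolynomial (Fin n) K) :
    ∃ s : Finset ℕ, m = ∑ j ∈ s, gradedPart deg 0 j m := by
  classical
  refine ⟨Finset.univ.biUnion fun l => (m l).support.image fun u => 0 + deg l + u.degree, ?_⟩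
  ext l u
  rw [Finset.sum_apply, coeff_sum]
  simp only [coeff_gradedPart]
  rw [Finset.sum_ite_eq]
  split_ifs with h
  · rfl
  · by_contra h0
    refine h (Finset.mem_biUnion.2 ⟨l, Finset.mem_univ l, Finset.mem_image.2 ⟨u, ?_, rfl⟩⟩)
    exact mem_support_iff.2 h0

theorem IsGraded.exists_homogeneous_generators [Fintype ι] {deg : ι → ℕ}
    {B : Submodule (MvPolynomial (Fin n) K) (ι → MvPolynomial (Fin n) K)} (hB : IsGraded deg B) :
    ∃ (t : ℕ) (b : Fin t → ι → MvPolynomial (Fin n) K),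
      (∀ k, ∃ j, IsHomogeneousElt deg j (b k)) ∧
        Submodule.span (MvPolynomial (Fin n) K) (Set.range b) = B := by
  have hspan : Submodule.span (MvPolynomial (Fin n) K)
      {m | m ∈ B ∧ ∃ j, IsHomogeneousElt deg j m} = B := by
    refine le_antisymm (Submodule.span_le.2 fun m hm => hm.1) fun m hm => ?_
    obtain ⟨s, hs⟩ := exists_sum_gradedPart deg m
    rw [hs]
    exact Submodule.sum_mem _ fun j _ => Submodule.subset_span
      ⟨hB _ _ _ hm, j, isHomogeneousElt_gradedPart _ _ _⟩
  have hfg : B.FG := IsNoetherian.noetherian B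
  rw [← hspan, Submodule.fg_span_iff_fg_span_finset_subset] at hfg
  obtain ⟨s, hs, hs'⟩ := hfg
  refine ⟨s.card, fun k => (s.equivFin.symm k : ι → MvPolynomial (Fin n) K),
    fun k => (hs (s.equivFin.symm k).2).2, ?_⟩
  rw [← hspan, hs']
  congr 1
  ext m
  constructor
  · rintro ⟨k, rfl⟩
    exact (s.equivFin.symm k).2
  · intro hm
    exact ⟨s.equivFin ⟨m, hm⟩, by simp⟩

/-- A graded submodule of a graded free module has a minimal graded free cover. -/
theorem IsGraded.exists_minimal_cover [Fintype ι] {deg : ι → ℕ}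
    {B : Submodule (MvPolynomial (Fin n) K) (ι → MvPolynomial (Fin n) K)} (hB : IsGraded deg B) :
    ∃ (t : ℕ) (d : Fin t → ℕ)
      (f : (Fin t → MvPolynomial (Fin n) K) →ₗ[MvPolynomial (Fin n) K]
        (ι → MvPolynomial (Fin n) K)),
      IsHomogeneousMap d deg f ∧ LinearMap.range f = B ∧ NoConstantTerm (LinearMap.ker f) := by
  classical
  have hex := hB.exists_homogeneous_generators
  -- The number `t` of homogeneous generators is taken least possible, so no generator can be
  -- dropped.
  obtain ⟨t, ⟨b, hb, hbB⟩, hmin⟩ : ∃ t : ℕ, (∃ b : Fin t → ι → MvPolynomial (Fin n) K,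
      (∀ k, ∃ j, IsHomogeneousElt deg j (b k)) ∧
        Submodule.span (MvPolynomial (Fin n) K) (Set.range b) = B) ∧
      ∀ q < t, ¬ ∃ b : Fin q → ι → MvPolynomial (Fin n) K,
      (∀ k, ∃ j, IsHomogeneousElt deg j (b k)) ∧
        Submodule.span (MvPolynomial (Fin n) K) (Set.range b) = B :=
    ⟨Nat.find hex, Nat.find_spec hex, fun _ => Nat.find_min hex⟩
  choose d hd using hb
  have hsingle : ∀ k, Fintype.linearCombination (MvPolynomial (Fin n) K) b (Pi.single k 1) =
      b k := by
    intro k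
    rw [Fintype.linearCombination_apply_single, one_smul]
  have hf : IsHomogeneousMap d deg (Fintype.linearCombination (MvPolynomial (Fin n) K) b) := by
    intro k l u hu
    rw [hsingle, mem_support_iff] at hu
    exact hd k l u hu
  refine ⟨t, d, Fintype.linearCombination (MvPolynomial (Fin n) K) b, hf, ?_, ?_⟩
  · rw [Fintype.range_linearCombination, hbB]
  · intro m hm k
    by_contra hk
    -- The component of degree `d k` of the relation `m` is again a relation, and its coefficient at
    -- `b k` is a nonzero constant. Solving for `b k` removes it from the generators, against the
    -- choice of `t`.
    have hm' : Fintype.linearCombination (MvPolynomial (Fin n) K) b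
        (gradedPart d 0 (d k) m) = 0 := by
      rw [hf.map_gradedPart, LinearMap.mem_ker.1 hm, map_zero]
    have hc : gradedPart d 0 (d k) m k = C (constantCoeff (m k)) := by
      ext u
      rw [coeff_gradedPart, coeff_C]
      by_cases hu : u = 0
      · subst hu
        simp [constantCoeff_eq]
      · rw [if_neg (Ne.symm hu), if_neg]
        have := (Finsupp.degree_eq_zero_iff u).not.2 hu
        omega
    obtain ⟨q, hq⟩ : ∃ q, t = q + 1 := ⟨t - 1, by have := k.pos; omega⟩
    refine hmin q (by omega) ?_
    subst hq
    refine ⟨fun x => b (k.succAbove x), fun x => ⟨_, hd _⟩, ?_⟩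
    rw [← hbB]
    refine le_antisymm (Submodule.span_mono ?_) (Submodule.span_le.2 ?_)
    · rintro _ ⟨x, rfl⟩
      exact ⟨_, rfl⟩
    · have hmem : ∀ x, b (k.succAbove x) ∈ Submodule.span (MvPolynomial (Fin n) K)
          (Set.range fun x => b (k.succAbove x)) := fun x => Submodule.subset_span ⟨x, rfl⟩
      rintro _ ⟨x, rfl⟩
      rcases Fin.eq_self_or_eq_succAbove k x with rfl | ⟨y, rfl⟩
      · rw [Fintype.linearCombination_apply, Fin.sum_univ_succAbove _ x, hc] at hm'
        have h1 : b x = (C (constantCoeff (m x))⁻¹ : MvPolynomial (Fin n) K) •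
            (-∑ y, gradedPart d 0 (d x) m (x.succAbove y) • b (x.succAbove y)) := by
          rw [← eq_neg_of_add_eq_zero_left hm', smul_smul, ← C_mul, inv_mul_cancel₀ hk, C_1,
            one_smul]
        rw [h1]
        exact Submodule.smul_mem _ _ (Submodule.neg_mem _ (Submodule.sum_mem _ fun y _ =>
          Submodule.smul_mem _ _ (hmem y)))
      · exact hmem y

/-- A graded submodule of a finite graded free module. -/
structure GradedSyzygy (K : Type*) [Field K] (n : ℕ) where
  /-- the rank of the ambient free module -/
  rank : ℕ
  /-- the degrees of the basis elements -/
  deg : Fin rank → ℕ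
  /-- the submodule -/
  module : Submodule (MvPolynomial (Fin n) K) (Fin rank → MvPolynomial (Fin n) K)
  /-- the submodule is graded -/
  graded : IsGraded deg module

theorem IsHomogeneousMap.isGraded_ker [Fintype κ] [DecidableEq κ] {deg' : κ → ℕ} {deg : ι → ℕ}
    {f : (κ → MvPolynomial (Fin n) K) →ₗ[MvPolynomial (Fin n) K] (ι → MvPolynomial (Fin n) K)}
    (hf : IsHomogeneousMap deg' deg f) : IsGraded deg' (LinearMap.ker f) := by
  intro c j m hm
  rw [LinearMap.mem_ker, hf.map_gradedPart, LinearMap.mem_ker.1 hm, map_zero]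

theorem GradedSyzygy.exists_next (s : GradedSyzygy K n) :
    ∃ (s' : GradedSyzygy K n)
      (f : (Fin s'.rank → MvPolynomial (Fin n) K) →ₗ[MvPolynomial (Fin n) K]
        (Fin s.rank → MvPolynomial (Fin n) K)),
      IsHomogeneousMap s'.deg s.deg f ∧ LinearMap.range f = s.module ∧
        s'.module = LinearMap.ker f ∧ NoConstantTerm s'.module := by
  obtain ⟨t, d, f, hf, hr, hmin⟩ := s.graded.exists_minimal_cover
  exact ⟨⟨t, d, LinearMap.ker f, hf.isGraded_ker⟩, f, hf, hr, rfl, hmin⟩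

/-- A graded ideal has a minimal graded free resolution. -/
theorem nonempty_minimalGradedFreeResolution {I : Ideal (MvPolynomial (Fin n) K)}
    (hI : IsGraded (fun _ => 0) (idealSubmodule I)) :
    Nonempty (MinimalGradedFreeResolution I) := by
  choose next f hf hr hk hmin using fun s : GradedSyzygy K n => s.exists_next
  -- The ideal itself is `s₀`, and `s i` is the kernel of the map out of `F_i`; thus `f s₀` is the
  -- augmentation and `f (s i)` is the differential `F_{i+1} → F_i`.
  let s₀ : GradedSyzygy K n := ⟨1, fun _ => 0, idealSubmodule I, hI⟩
  let s : ℕ → GradedSyzygy K n := fun i => Nat.rec (next s₀) (fun _ => next) i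
  refine ⟨{
    rank := fun i => (s i).rank
    deg := fun i => (s i).deg
    aug := (LinearMap.proj (0 : Fin 1)).comp (f s₀)
    d := fun i => f (s i)
    range_aug := ?_
    exact_zero := ?_
    exact_succ := fun i => (hr (s (i + 1))).trans (hk (s i))
    aug_homogeneous := fun k u hu => hf s₀ k (0 : Fin 1) u hu
    d_homogeneous := fun i k l u hu => hf (s i) k l u hu
    minimal := ?_ }⟩
  · ext x
    constructor
    · rintro ⟨y, rfl⟩
      have h : f s₀ y ∈ idealSubmodule I := by
        have := LinearMap.mem_range_self (f s₀) y
        rwa [hr s₀] at this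
      exact h
    · intro hx
      have h : (fun _ => x : Fin 1 → MvPolynomial (Fin n) K) ∈ LinearMap.range (f s₀) := by
        rw [hr s₀]
        exact hx
      obtain ⟨y, hy⟩ := h
      exact ⟨y, congrFun hy 0⟩
  · refine (hr (s 0)).trans ((hk s₀).trans ?_)
    ext y
    constructor
    · intro h
      exact congrFun (LinearMap.mem_ker.1 h) (0 : Fin 1)
    · intro h
      refine LinearMap.mem_ker.2 (funext fun l => ?_)
      have hl : l = (0 : Fin 1) := Subsingleton.elim _ _
      subst hl
      exact h
  · intro i k l
    cases i with
    | zero =>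
      refine hmin s₀ _ ?_ l
      change _ ∈ (s 0).module
      rw [← hr (s 0)]
      exact LinearMap.mem_range_self _ _
    | succ i =>
      refine hmin (s i) _ ?_ l
      change _ ∈ (s (i + 1)).module
      rw [← hr (s (i + 1))]
      exact LinearMap.mem_range_self _ _

/-! ### Monomial ideals -/

/-- The ideal consists of the polynomials all of whose exponents lie in `E`. -/
def HasExponents (I : Ideal (MvPolynomial (Fin n) K)) (E : Set (Fin n →₀ ℕ)) : Prop :=
  ∀ f, f ∈ I ↔ ∀ u, coeff u f ≠ 0 → u ∈ E

theorem hasExponents_top : HasExponents (⊤ : Ideal (MvPolynomial (Fin n) K)) Set.univ := by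
  intro f
  simp

theorem HasExponents.monomial_mem_iff {I : Ideal (MvPolynomial (Fin n) K)}
    {E : Set (Fin n →₀ ℕ)} (hI : HasExponents I E) (u : Fin n →₀ ℕ) :
    monomial u (1 : K) ∈ I ↔ u ∈ E := by
  classical
  rw [hI]
  constructor
  · intro h
    exact h u (by simp)
  · intro h v hv
    rw [coeff_monomial] at hv
    split_ifs at hv with huv
    · rwa [← huv]
    · exact absurd rfl hv

theorem HasExponents.isGraded {I : Ideal (MvPolynomial (Fin n) K)} {E : Set (Fin n →₀ ℕ)}
    (hI : HasExponents I E) : IsGraded (fun _ => 0) (idealSubmodule I) := by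
  intro c j m hm
  rw [mem_idealSubmodule, hI] at hm ⊢
  intro u hu
  rw [coeff_gradedPart] at hu
  split_ifs at hu
  · exact hm u hu
  · exact absurd rfl hu

theorem HasExponents.divVar_mem {I : Ideal (MvPolynomial (Fin n) K)} {E : Set (Fin n →₀ ℕ)}
    (hI : HasExponents I E) {k : Fin n} (hk : ∀ u, Finsupp.single k 1 + u ∈ E → u ∈ E)
    {m : Fin 1 → MvPolynomial (Fin n) K} (hm : m ∈ idealSubmodule I) :
    divVar k m ∈ idealSubmodule I := by
  rw [mem_idealSubmodule, hI] at hm ⊢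
  exact fun u hu => hk u (hm _ hu)

/-- The exponents of the monomials in `(x_1^{a_1}, …, x_r^{a_r})`. -/
def irredExponents (r : ℕ) (a : Fin n → ℕ) : Set (Fin n →₀ ℕ) :=
  {u | ∃ j : Fin n, (j : ℕ) < r ∧ a j ≤ u j}

theorem hasExponents_irredIdeal (r : ℕ) (a : Fin n → ℕ) :
    HasExponents (irredIdeal K r a) (irredExponents r a) := by
  intro f
  have h : irredIdeal K r a = Ideal.span ((fun s => monomial s (1 : K)) ''
      {u | ∃ j : Fin n, (j : ℕ) < r ∧ u = Finsupp.single j (a j)}) := by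
    rw [irredIdeal]
    congr 1
    ext p
    constructor
    · rintro ⟨j, hj, rfl⟩
      exact ⟨_, ⟨j, hj, rfl⟩, (X_pow_eq_monomial ..).symm⟩
    · rintro ⟨_, ⟨j, hj, rfl⟩, rfl⟩
      exact ⟨j, hj, (X_pow_eq_monomial ..).symm⟩
  rw [h, mem_ideal_span_monomial_image]
  refine forall_congr' fun u => ?_
  rw [mem_support_iff]
  refine imp_congr_right fun _ => ?_
  constructor
  · rintro ⟨_, ⟨j, hj, rfl⟩, hu⟩
    exact ⟨j, hj, Finsupp.single_le_iff.1 hu⟩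
  · rintro ⟨j, hj, hu⟩
    exact ⟨_, ⟨j, hj, rfl⟩, Finsupp.single_le_iff.2 hu⟩

/-! ### Regularity of an intersection with an irreducible monomial ideal -/

/-- The only Koszul homology of `S` is `K` in bidegree `(0, 0)`, which `p < j` excludes. -/
theorem koszulAcyclic_top {p j : ℕ} (h : p < j) :
    KoszulAcyclic (fun _ => 0) (idealSubmodule (⊤ : Ideal (MvPolynomial (Fin n) K))) p j := by
  intro z _ hzb hdz
  obtain ⟨w, hw⟩ := exists_koszulD_eq hdz (by
    intro l
    by_contra h0
    have := (hzb ∅ l 0 h0).2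
    simp at this
    omega)
  exact ⟨w, fun _ => trivial, hw⟩

/-- The exponents `a_j - 1` for `j < r`, and zero for the other variables. -/
noncomputable def socleExponent (r : ℕ) (a : Fin n → ℕ) : Fin n →₀ ℕ :=
  Finsupp.equivFunOnFinite.symm fun j => if (j : ℕ) < r then a j - 1 else 0

theorem socleExponent_apply (r : ℕ) (a : Fin n → ℕ) (j : Fin n) :
    socleExponent r a j = if (j : ℕ) < r then a j - 1 else 0 :=
  rfl

theorem degree_le_of_le {u v : Fin n →₀ ℕ} (h : u ≤ v) : u.degree ≤ v.degree := by
  rw [← tsub_add_cancel_of_le h, map_add]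
  exact Nat.le_add_left _ _

section Inter

variable {I₀ I₁ : Ideal (MvPolynomial (Fin n) K)} {E : Set (Fin n →₀ ℕ)} {r : ℕ} {a : Fin n → ℕ}

/-- A cycle over `I₀` bounds some `w` over `I₁`, and `w` is then a relative cycle for `I₀ ⊆ I₁`.
Modulo boundaries over `I₁` and chains over `I₀` it may be taken free of the variables from index
`r` on; its monomials are then too large in degree to avoid `Q`, so the correction of `w` lies over
`I₀`. -/
theorem koszulAcyclic_inter (h₁ : HasExponents I₁ E)
    (h₀ : HasExponents I₀ (E ∩ irredExponents r a))
    (hE : ∀ k : Fin n, r ≤ k → ∀ u, Finsupp.single k 1 + u ∈ E → u ∈ E) {p j : ℕ}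
    (hpj : p + (socleExponent r a).degree + 1 < j)
    (hac : KoszulAcyclic (fun _ => 0) (idealSubmodule I₁) p j) :
    KoszulAcyclic (fun _ => 0) (idealSubmodule I₀) p j := by
  intro z hz hzb hdz
  have h01 : idealSubmodule I₀ ≤ idealSubmodule I₁ := by
    intro m hm
    rw [mem_idealSubmodule, h₀] at hm
    rw [mem_idealSubmodule, h₁]
    exact fun u hu => (hm u hu).1
  obtain ⟨w₀, hw₀, hdw₀⟩ := hac z (fun A => h01 (hz A)) hzb hdz
  have hw : ∀ A, bihomPart (fun _ => 0) (p + 1) j w₀ A ∈ idealSubmodule I₁ := by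
    intro A
    rw [bihomPart]
    split_ifs
    · exact h₁.isGraded _ _ _ (hw₀ A)
    · exact Submodule.zero_mem _
  have hdw : koszulD K (bihomPart (fun _ => 0) (p + 1) j w₀) = z := by
    rw [koszulD_bihomPart, hdw₀, hzb.bihomPart_eq]
  have hwb := bihomogeneous_bihomPart (fun _ => 0) (p + 1) j w₀
  set w := bihomPart (fun _ => 0) (p + 1) j w₀
  obtain ⟨v, y, -, hy, hvy, hsupp⟩ := exists_reduction
    (Finset.univ.filter fun k : Fin n => r ≤ k) h01
    (fun k hk m hm => h₁.divVar_mem (hE k (Finset.mem_filter.1 hk).2) hm)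
    (fun k hk m hm => h₀.divVar_mem (fun u hu => by
      have hk' := (Finset.mem_filter.1 hk).2
      refine ⟨hE k hk' u hu.1, ?_⟩
      obtain ⟨i, hi, hai⟩ := hu.2
      refine ⟨i, hi, ?_⟩
      have hki : k ≠ i := by
        rintro rfl
        omega
      rwa [Finsupp.add_apply, Finsupp.single_eq_of_ne hki.symm, zero_add] at hai) hm)
    hw (by
      rw [hdw]
      exact hz)
  refine ⟨w - koszulD K v, fun A => ?_, by rw [map_sub, koszulD_koszulD, sub_zero, hdw]⟩
  have hyA : y A ∈ idealSubmodule I₀ := by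
    rw [mem_idealSubmodule, h₀]
    intro u hu
    refine ⟨(h₁ _).1 (hy A) u hu, ?_⟩
    obtain ⟨hu1, hu2⟩ := hsupp A 0 u hu
    have hdeg := (hwb A 0 u hu1).2
    by_contra hQ
    -- A monomial outside `Q` in the first `r` variables divides the socle monomial, but `u` has
    -- degree `j - (p + 1)`, which exceeds the socle degree.
    have hle : u ≤ socleExponent r a := by
      intro i
      rw [socleExponent_apply]
      split_ifs with hi
      · by_contra hlt
        exact hQ ⟨i, hi, by omega⟩
      · exact (hu2 i (Finset.mem_filter.2 ⟨Finset.mem_univ i, not_lt.1 hi⟩)).2.le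
    have := degree_le_of_le hle
    dsimp only at hdeg
    omega
  have h := (idealSubmodule I₀).add_mem (hvy A) hyA
  rwa [Pi.sub_apply (w - koszulD K v), sub_add_cancel] at h

/-- Take `y = x^{a-1} e_1 ∧ ⋯ ∧ e_r`. Multiplying `x^{a-1}` by any of the first `r` variables lands
in `Q`, so `dy` is a cycle over `I₀`. If `dy = dw` with `w` over `I₀`, then `y - w` is a boundary
over `S`. The coefficient of `x^{a-1}` at `T` excludes this. -/
theorem not_koszulAcyclic_inter (h₁ : HasExponents I₁ E)
    (h₀ : HasExponents I₀ (E ∩ irredExponents r a)) (hr : 1 ≤ r) (hrn : r ≤ n)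
    (ha : ∀ j : Fin n, (j : ℕ) < r → 0 < a j) (hv : socleExponent r a ∈ E) :
    ¬ KoszulAcyclic (fun _ => 0) (idealSubmodule I₀) (r - 1)
      ((socleExponent r a).degree + r) := by
  classical
  intro h
  set T : Finset (Fin n) := Finset.univ.filter fun j => (j : ℕ) < r with hT
  have hTcard : T.card = r := by
    rw [hT, Fin.card_filter_val_lt, min_eq_right hrn]
  have hTne : T ≠ ∅ := by
    intro h0
    rw [h0, Finset.card_empty] at hTcard
    omega
  set y : KoszulChain n (Fin 1 → MvPolynomial (Fin n) K) :=
    Pi.single T fun _ => monomial (socleExponent r a) 1 with hy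
  have hyb : Bihomogeneous (fun _ => 0) (r - 1 + 1) ((socleExponent r a).degree + r) y := by
    intro A l u hu
    by_cases hA : A = T
    · subst hA
      rw [hy, Pi.single_eq_same, coeff_monomial] at hu
      split_ifs at hu with huv
      · rw [← huv]
        dsimp only
        omega
      · exact absurd rfl hu
    · simp [hy, Pi.single_eq_of_ne hA] at hu
  obtain ⟨w, hw, hdw⟩ := h (koszulD K y) (fun A => by
    rw [koszulD_apply]
    refine Submodule.sum_mem _ fun k _ => (idealSubmodule I₀).toAddSubgroup.zsmul_mem ?_ _
    change _ ∈ idealSubmodule I₀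
    by_cases hA : insert k A = T
    · have hk : (k : ℕ) < r := by
        have : k ∈ T := by
          rw [← hA]
          exact Finset.mem_insert_self _ _
        simpa [hT] using this
      rw [hy, hA, Pi.single_eq_same, mem_idealSubmodule]
      change X k * monomial (socleExponent r a) (1 : K) ∈ I₀
      have hmul : X k * monomial (socleExponent r a) (1 : K) =
          monomial (Finsupp.single k 1 + socleExponent r a) 1 := by
        rw [X, monomial_mul, one_mul]
      rw [hmul, h₀.monomial_mem_iff]
      refine ⟨?_, k, hk, ?_⟩
      · rw [← h₁.monomial_mem_iff, ← hmul]
        exact Ideal.mul_mem_left _ _ ((h₁.monomial_mem_iff _).2 hv)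
      · rw [Finsupp.add_apply, Finsupp.single_eq_same, socleExponent_apply, if_pos hk]
        omega
    · rw [hy, Pi.single_eq_of_ne hA, smul_zero]
      exact Submodule.zero_mem _) hyb.koszulD (koszulD_koszulD y)
  have hcoeff : ∀ A u, u ∉ irredExponents r a → coeff u (w A 0) = 0 := by
    intro A u hu
    by_contra h0
    exact hu ((h₀ _).1 (hw A) u h0).2
  -- Since `T ≠ ∅`, the entry at `∅` comes from `w` alone; it has no constant term because positive
  -- exponents `a j` keep `1` out of `Q`.
  obtain ⟨x, hx⟩ := exists_koszulD_eq (z := y - w) (by rw [map_sub, hdw, sub_self]) (by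
    intro l
    have hl : l = 0 := Subsingleton.elim _ _
    subst hl
    rw [Pi.sub_apply, hy, Pi.single_eq_of_ne hTne.symm, Pi.sub_apply, Pi.zero_apply, zero_sub,
      map_neg, neg_eq_zero]
    refine hcoeff ∅ 0 ?_
    rintro ⟨j, hj, haj⟩
    have := ha j hj
    simp at haj
    omega)
  -- On the side of `y - w` the coefficient is `1`, as `x^{a-1} ∉ Q`. On the side of `dx` it is `0`:
  -- at `T` only variables of index at least `r` occur as factors, and none divides `x^{a-1}`.
  have h1 := congrArg (coeff (socleExponent r a)) (congrFun (congrFun hx T) 0)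
  rw [Pi.sub_apply, Pi.sub_apply, coeff_sub, hcoeff, hy, Pi.single_eq_same, coeff_monomial,
    if_pos rfl, sub_zero, koszulD_apply, Finset.sum_apply, coeff_sum, Finset.sum_eq_zero] at h1
  · exact zero_ne_one h1
  · intro k hk
    have hkr : ¬ (k : ℕ) < r := by simpa [hT] using hk
    have h2 : coeff (socleExponent r a) (X k * x (insert k T) 0) = 0 := by
      rw [coeff_X_mul', if_neg]
      rw [Finsupp.mem_support_iff, not_not, socleExponent_apply, if_neg hkr]
    rcases neg_one_pow_eq_or ℤ (T.filter (· < k)).card with hs | hs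
    · simp [koszulSign, hs, h2]
    · simp [koszulSign, hs, h2]
  · rintro ⟨j, hj, haj⟩
    have := ha j hj
    rw [socleExponent_apply, if_pos hj] at haj
    omega

theorem hasRegularity_inter (h₁ : HasExponents I₁ E)
    (h₀ : HasExponents I₀ (E ∩ irredExponents r a)) (hr : 1 ≤ r) (hrn : r ≤ n)
    (ha : ∀ j : Fin n, (j : ℕ) < r → 0 < a j) (hv : socleExponent r a ∈ E)
    (hE : ∀ k : Fin n, r ≤ k → ∀ u, Finsupp.single k 1 + u ∈ E → u ∈ E)
    (hac : ∀ p j, p + (socleExponent r a).degree + 1 < j →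
      KoszulAcyclic (fun _ => 0) (idealSubmodule I₁) p j) :
    HasRegularity I₀ ((socleExponent r a).degree + 1 : ℤ) := by
  refine ⟨nonempty_minimalGradedFreeResolution h₀.isGraded, fun F => ⟨?_, ?_⟩⟩
  · exact ⟨r - 1, (socleExponent r a).degree + r,
      (F.betti_ne_zero_iff _ _).2 (not_koszulAcyclic_inter h₁ h₀ hr hrn ha hv), by omega⟩
  · rintro _ ⟨p, j, hpj, rfl⟩
    rw [F.betti_ne_zero_iff] at hpj
    by_contra hlt
    have hlt' : p + (socleExponent r a).degree + 1 < j := by omega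
    exact hpj (koszulAcyclic_inter h₁ h₀ hE hlt' (hac p j hlt'))

end Inter

theorem degree_socleExponent {r : ℕ} {a : Fin n → ℕ} (hrn : r ≤ n)
    (ha : ∀ j : Fin n, (j : ℕ) < r → 0 < a j) :
    ((socleExponent r a).degree : ℤ) + 1 =
      (∑ j ∈ Finset.univ.filter (fun j : Fin n => (j : ℕ) < r), (a j : ℤ)) - (r : ℤ) + 1 := by
  have hcard : ((Finset.univ.filter fun j : Fin n => (j : ℕ) < r).card : ℤ) = r := by
    rw [Fin.card_filter_val_lt, min_eq_right hrn]
  rw [Finsupp.degree_eq_sum]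
  simp only [socleExponent_apply]
  rw [← Finset.sum_filter, Nat.cast_sum, ← hcard, Finset.card_eq_sum_ones, Nat.cast_sum,
    ← Finset.sum_sub_distrib]
  congr 1
  refine Finset.sum_congr rfl fun j hj => ?_
  have := ha j (Finset.mem_filter.1 hj).2
  omega

/-! ### Chains of irreducible monomial ideals -/

section Tail

variable {m : ℕ} {N : Fin (m + 1) → ℕ} {a : Fin (m + 1) → Fin n → ℕ}

/-- The exponents of the monomials in `⋂_{j > i} Q_j`. -/
def laterExponents (N : Fin (m + 1) → ℕ) (a : Fin (m + 1) → Fin n → ℕ) (i : Fin (m + 1)) :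
    Set (Fin n →₀ ℕ) :=
  {u | ∀ k, i < k → u ∈ irredExponents (N k) (a k)}

theorem hasExponents_tailInter (i : Fin (m + 1)) :
    HasExponents (tailInter (fun k => irredIdeal K (N k) (a k)) i)
      (laterExponents N a i ∩ irredExponents (N i) (a i)) := by
  intro f
  simp only [tailInter, Submodule.mem_iInf, hasExponents_irredIdeal _ _ f]
  constructor
  · exact fun h u hu => ⟨fun k hk => h k hk.le u hu, h i le_rfl u hu⟩
  · intro h k hk u hu
    rcases hk.eq_or_lt with rfl | hk
    · exact (h u hu).2
    · exact (h u hu).1 k hk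

theorem hasExponents_tailInter_succ (i : Fin m) :
    HasExponents (tailInter (fun k => irredIdeal K (N k) (a k)) i.succ)
      (laterExponents N a i.castSucc) := by
  intro f
  simp only [tailInter, Submodule.mem_iInf, hasExponents_irredIdeal _ _ f]
  constructor
  · exact fun h u hu k hk => h k (Fin.castSucc_lt_iff_succ_le.1 hk) u hu
  · exact fun h k hk u hu => h u hu k (Fin.castSucc_lt_iff_succ_le.2 hk)

theorem laterExponents_last : laterExponents N a (Fin.last m) = Set.univ :=
  Set.eq_univ_of_forall fun _ k hk => absurd hk (Fin.le_last k).not_gt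

/-- For `l > i` the ideal `Q_l` involves only variables of index below `N l < N i`, so a factor `X
k` does not affect membership. -/
theorem mem_laterExponents_of_single_add (hN : StrictAnti N) {i : Fin (m + 1)} {k : Fin n}
    (hk : N i ≤ k) (u : Fin n →₀ ℕ) (hu : Finsupp.single k 1 + u ∈ laterExponents N a i) :
    u ∈ laterExponents N a i := by
  intro l hl
  obtain ⟨j, hj, haj⟩ := hu l hl
  have := hN hl
  have hkj : k ≠ j := by
    rintro rfl
    omega
  refine ⟨j, hj, ?_⟩
  rwa [Finsupp.add_apply, Finsupp.single_eq_of_ne hkj.symm, zero_add] at haj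

/-- Irredundance yields a monomial `u` lying in every other `Q_k` but not in `Q_i`. On the first `N
i` variables `u` is bounded by the socle exponent of `Q_i`, and for `k > i` membership in `Q_k` is
witnessed on these variables, so it passes to the socle monomial. -/
theorem socleExponent_mem_laterExponents (hN : StrictAnti N)
    (hirr : Irredundant fun i => irredIdeal K (N i) (a i)) (i : Fin (m + 1)) :
    socleExponent (N i) (a i) ∈ laterExponents N a i := by
  obtain ⟨f, hf, hfi⟩ := SetLike.not_le_iff_exists.1 (hirr i)
  simp only [hasExponents_irredIdeal _ _ f, not_forall] at hfi
  obtain ⟨u, hu, hui⟩ := hfi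
  simp only [Submodule.mem_iInf, hasExponents_irredIdeal _ _ f] at hf
  intro k hk
  obtain ⟨j, hj, haj⟩ := hf k hk.ne' u hu
  have hji : (j : ℕ) < N i := hj.trans (hN hk)
  refine ⟨j, hj, ?_⟩
  rw [socleExponent_apply, if_pos hji]
  by_contra hlt
  exact hui ⟨j, hji, by omega⟩

/-- The comparison of exponents enters the proof only here: the socle monomial of `Q_{i+1}` divides
that of `Q_i`. -/
theorem degree_socleExponent_succ_le (hN : StrictAnti N)
    (hmono : ∀ (i : Fin m) (j : Fin n), (j : ℕ) < N i.succ → a i.succ j ≤ a i.castSucc j)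
    (i : Fin m) : (socleExponent (N i.succ) (a i.succ)).degree ≤
      (socleExponent (N i.castSucc) (a i.castSucc)).degree := by
  refine degree_le_of_le fun j => ?_
  rw [socleExponent_apply, socleExponent_apply]
  split_ifs with h1 h2
  · have := hmono i j h1
    omega
  · exact absurd (h1.trans (hN (Fin.castSucc_lt_succ (i := i)))) h2
  · exact Nat.zero_le _
  · exact le_rfl

/-- Descending induction from the last ideal, where `I₁ = S`; the range of degrees for `i` is
contained in that for `i + 1` because socle degrees decrease. -/
theorem koszulAcyclic_tailInter (hN : StrictAnti N)
    (hmono : ∀ (i : Fin m) (j : Fin n), (j : ℕ) < N i.succ → a i.succ j ≤ a i.castSucc j)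
    (i : Fin (m + 1)) : ∀ p j, p + (socleExponent (N i) (a i)).degree + 1 < j →
      KoszulAcyclic (fun _ => 0)
        (idealSubmodule (tailInter (fun k => irredIdeal K (N k) (a k)) i)) p j := by
  induction i using Fin.reverseInduction with
  | last =>
    intro p j hpj
    refine koszulAcyclic_inter (I₁ := ⊤) (E := laterExponents N a (Fin.last m)) ?_
      (hasExponents_tailInter _) (fun k hk => mem_laterExponents_of_single_add hN hk) hpj
      (koszulAcyclic_top (by omega))
    rw [laterExponents_last]
    exact hasExponents_top
  | cast i ih =>
    intro p j hpj
    have := degree_socleExponent_succ_le hN hmono i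
    exact koszulAcyclic_inter (hasExponents_tailInter_succ i) (hasExponents_tailInter _)
      (fun k hk => mem_laterExponents_of_single_add hN hk) hpj (ih p j (by omega))

theorem hasRegularity_tailInter (hN : StrictAnti N) (hN_le : ∀ i, N i ≤ n)
    (hN_pos : ∀ i, 1 ≤ N i) (ha : ∀ (i : Fin (m + 1)) (j : Fin n), (j : ℕ) < N i → 0 < a i j)
    (hirr : Irredundant fun i => irredIdeal K (N i) (a i))
    (hmono : ∀ (i : Fin m) (j : Fin n), (j : ℕ) < N i.succ → a i.succ j ≤ a i.castSucc j)
    (i : Fin (m + 1)) :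
    HasRegularity (tailInter (fun k => irredIdeal K (N k) (a k)) i)
      ((socleExponent (N i) (a i)).degree + 1 : ℤ) := by
  have hv := socleExponent_mem_laterExponents hN hirr i
  have hE := fun (k : Fin n) (hk : N i ≤ k) =>
    mem_laterExponents_of_single_add (a := a) hN (i := i) hk
  induction i using Fin.lastCases with
  | last =>
    refine hasRegularity_inter (I₁ := ⊤) ?_ (hasExponents_tailInter _) (hN_pos _) (hN_le _)
      (ha _) hv hE fun p j hpj => koszulAcyclic_top (by omega)
    rw [laterExponents_last]
    exact hasExponents_top
  | cast i =>
    have := degree_socleExponent_succ_le hN hmono i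
    exact hasRegularity_inter (hasExponents_tailInter_succ i) (hasExponents_tailInter _)
      (hN_pos _) (hN_le _) (ha _) hv hE fun p j hpj =>
        koszulAcyclic_tailInter hN hmono i.succ p j (by omega)

theorem hasRegularity_irredIdeal {r : ℕ} {b : Fin n → ℕ} (hr : 1 ≤ r) (hrn : r ≤ n)
    (hb : ∀ j : Fin n, (j : ℕ) < r → 0 < b j) :
    HasRegularity (irredIdeal K r b) ((socleExponent r b).degree + 1 : ℤ) := by
  refine hasRegularity_inter hasExponents_top ?_ hr hrn hb (Set.mem_univ _)
    (fun _ _ _ _ => Set.mem_univ _) fun p j hpj => koszulAcyclic_top (by omega)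
  rw [Set.univ_inter]
  exact hasExponents_irredIdeal r b

end Tail

end BorelType

theorem corollary1p5 {K : Type*} [Field K] (n m : ℕ) (N : Fin (m + 1) → ℕ)
    (hN : StrictAnti N) (hN_le : ∀ i, N i ≤ n) (hN_pos : ∀ i, 1 ≤ N i)
    (a : Fin (m + 1) → Fin n → ℕ)
    (ha : ∀ (i : Fin (m + 1)) (j : Fin n), (j : ℕ) < N i → 0 < a i j)
    (hirr : BorelType.Irredundant fun i => BorelType.irredIdeal K (N i) (a i))
    (hmono : ∀ (i : Fin m) (j : Fin n), (j : ℕ) < N i.succ → a i.succ j ≤ a i.castSucc j)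
    (i : Fin (m + 1)) :
    BorelType.HasRegularity
        (BorelType.tailInter (fun k => BorelType.irredIdeal K (N k) (a k)) i)
        ((∑ j ∈ Finset.univ.filter (fun j : Fin n => (j : ℕ) < N i), (a i j : ℤ)) - (N i : ℤ) + 1) ∧
      BorelType.HasRegularity (BorelType.irredIdeal K (N i) (a i))
        ((∑ j ∈ Finset.univ.filter (fun j : Fin n => (j : ℕ) < N i), (a i j : ℤ)) - (N i : ℤ) + 1) := by
  rw [← BorelType.degree_socleExponent (hN_le i) (ha i)]
  exact ⟨BorelType.hasRegularity_tailInter hN hN_le hN_pos ha hirr hmono i,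
    BorelType.hasRegularity_irredIdeal (hN_pos i) (hN_le i) (ha i)⟩
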